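/- Let $T>0$, $\gamma\in(1/2,1)$, $\kappa\in\mathbb R$, let $m,d\ge 1$, let $a\in\mathbb R^m\setminus\{0\}$, let $x:[0,T]\to\mathbb R^d$ and $\sigma^1,\dots,\sigma^d:\mathbb R^m\to\mathbb R^m$. Assume the following. 1. (Coefficients.) $0<\kappa<1$ and $\gamma(\kappa+1)<1$. For every $j$ one has $\sigma^j(0)=0$, there is a constant $C$ with $|\sigma^j(\xi_2)-\sigma^j(\xi_1)|\le C\,\big||\xi_2|^\kappa-|\xi_1|^\kappa\big|$ for all $\xi_1,\xi_2\in\mathbb R^m$, there is a constant $c>0$ with $|\sigma^j(\xi)|\ge c|\xi|^\kappa$ for all $\xi\in\mathbb R^m$, and $\sigma^j$ is differentiable on $\mathbb R^m\setminus\{0\}$ with $\nabla\sigma^j$ locally Hölder continuous there of some order larger than $\frac1\gamma-1$. 2. (Regularity of the noise.) There is $\varepsilon_1>0$ such that, with $\gamma_1=\gamma+\varepsilon_1$, the path $x$ is $\gamma_1$-Hölder continuous on $[0,T]$ and $\gamma_1+\gamma\kappa<1$. 3. (Roughness of the noise.) There are $\hat\varepsilon>0$ and $c>0$ such that for every $s\in[0,T]$,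 every $\epsilon\in(0,T/2]$ and every $\phi\in\mathbb R^d$ with $|\phi|=1$ there is $t\in[0,T]$ with $\epsilon/2<|t-s|<\epsilon$ and $|\langle\phi,x_t-x_s\rangle|>c\,\epsilon^{\gamma+\hat\varepsilon}$. 4. $\gamma+\kappa>1$. Consider the equation $$y_t=a+\sum_{j=1}^d\int_0^t\sigma^j(y_u)\,dx^j_u,\qquad(\ast)$$ where the integrals are Young integrals, that is, limits of Riemann sums as the mesh of the partition tends to $0$. Let $y:[0,T]\to\mathbb R^m$ be continuous and let $\tau\le T$ be such that one of the following holds: (A) $\tau=T$, $y_t\ne0$ for all $t\in[0,T]$, $y$ is $\gamma$-Hölder continuous on $[0,T]$, and $y$ solves $(\ast)$ on $[0,T]$; (B) $0<\tau\le T$; for every $t\in[0,\tau)$, $y$ is $\gamma$-Hölder continuous on $[0,t]$ and solves $(\ast)$ on $[0,t]$; $y_t\neq0$ for $t\in[0,\tau)$; $\lim_{t\uparrow\tau}y_t=0$; and $y_t=0$ for $t\in[\tau,T]$. Then $y$ is $\gamma$-Hölder continuous on the whole interval $[0,T]$, i.e. $y\in\mathcal C^\gamma([0,T];\mathbb R^m)$.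 -/

import Mathlib

open Set Filter Topology

/-- `f` is Hölder continuous of order `r` on `s` (the space `C^r(s)`): there is a finite
Hölder constant. Used for `r > 0` only. -/
def IsHolderOn {X Y : Type*} [PseudoEMetricSpace X] [PseudoEMetricSpace Y]
    (r : ℝ) (f : X → Y) (s : Set X) : Prop :=
  ∃ C : NNReal, HolderOnWith C r.toNNReal f s

/-- `f` is locally Hölder continuous of order `r` on `s`. -/
def IsLocallyHolderOn {X Y : Type*} [PseudoEMetricSpace X] [PseudoEMetricSpace Y]
    (r : ℝ) (f : X → Y) (s : Set X) : Prop :=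
  ∀ p ∈ s, ∃ U ∈ 𝓝[s] p, IsHolderOn r f U

/-- A tagged partition `a = t₀ ≤ t₁ ≤ ⋯ ≤ tₙ = b` with tags `ξᵢ ∈ [tᵢ, tᵢ₊₁]`, `i < n`
(the values of `pt` beyond `n` and of `tag` from `n` on are irrelevant). -/
structure TaggedPartition (a b : ℝ) where
  n : ℕ
  pt : ℕ → ℝ
  tag : ℕ → ℝ
  pt_first : pt 0 = a
  pt_last : pt n = b
  pt_le : ∀ i < n, pt i ≤ pt (i + 1)
  tag_mem : ∀ i < n, tag i ∈ Icc (pt i) (pt (i + 1))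

/-- All the intervals of the partition have length less than `δ`. -/
def TaggedPartition.MeshLT {a b : ℝ} (π : TaggedPartition a b) (δ : ℝ) : Prop :=
  ∀ i < π.n, π.pt (i + 1) - π.pt i < δ

/-- The Riemann sum `∑ᵢ f(ξᵢ) (g(tᵢ₊₁) - g(tᵢ))`. -/
def TaggedPartition.riemannSum {a b : ℝ} {E : Type*} [AddCommGroup E] [Module ℝ E]
    (π : TaggedPartition a b) (f : ℝ → E) (g : ℝ → ℝ) : E :=
  ∑ i ∈ Finset.range π.n, (g (π.pt (i + 1)) - g (π.pt i)) • f (π.tag i)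

/-- The Young integral `∫_a^b f dg` exists and equals `I`: the Riemann sums converge to `I`
as the mesh of the tagged partition tends to zero. -/
def HasYoungIntegral {E : Type*} [NormedAddCommGroup E] [NormedSpace ℝ E]
    (f : ℝ → E) (g : ℝ → ℝ) (a b : ℝ) (I : E) : Prop :=
  ∀ ε > 0, ∃ δ > 0, ∀ π : TaggedPartition a b, π.MeshLT δ → ‖π.riemannSum f g - I‖ < ε

/-- The vector field `σ` vanishes at the origin and
`|σ(ξ₂) - σ(ξ₁)| ≤ C ||ξ₂|^κ - |ξ₁|^κ|`, where `κ ∈ (0,1)` and `γ (κ + 1) < 1`. -/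
structure PowerHolder (γ κ : ℝ) {m : ℕ}
    (σ : EuclideanSpace ℝ (Fin m) → EuclideanSpace ℝ (Fin m)) : Prop where
  kappa_pos : 0 < κ
  kappa_lt_one : κ < 1
  exponent_lt : γ * (κ + 1) < 1
  map_zero : σ 0 = 0
  bound : ∃ C : ℝ, ∀ ξ₁ ξ₂ : EuclideanSpace ℝ (Fin m),
    ‖σ ξ₂ - σ ξ₁‖ ≤ C * |‖ξ₂‖ ^ κ - ‖ξ₁‖ ^ κ|

/-- `σ` behaves like a power function: in addition to `PowerHolder`, it satisfies
`|σ(ξ)| ≥ c |ξ|^κ` and is differentiable away from the origin, with a gradient that is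
locally Hölder continuous there of some order larger than `1/γ - 1`. -/
structure PowerType (γ κ : ℝ) {m : ℕ}
    (σ : EuclideanSpace ℝ (Fin m) → EuclideanSpace ℝ (Fin m)) : Prop
    extends PowerHolder γ κ σ where
  lower_bound : ∃ c > 0, ∀ ξ : EuclideanSpace ℝ (Fin m), c * ‖ξ‖ ^ κ ≤ ‖σ ξ‖
  differentiableAt : ∀ ξ : EuclideanSpace ℝ (Fin m), ξ ≠ 0 → DifferentiableAt ℝ σ ξ
  gradient_holder : ∃ β > 1 / γ - 1,
    IsLocallyHolderOn β (fderiv ℝ σ) {ξ : EuclideanSpace ℝ (Fin m) | ξ ≠ 0}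

/-- The path `x` is slightly more regular than `γ`-Hölder on `[0,T]`. -/
def ExtraRegular (γ κ T : ℝ) {d : ℕ} (x : ℝ → EuclideanSpace ℝ (Fin d)) : Prop :=
  ∃ ε₁ > 0, IsHolderOn (γ + ε₁) x (Icc 0 T) ∧ (γ + ε₁) + γ * κ < 1

/-- The path `x` is `θ`-Hölder rough on `[0,T]`. -/
def HolderRough (θ T : ℝ) {d : ℕ} (x : ℝ → EuclideanSpace ℝ (Fin d)) : Prop :=
  ∃ c > 0, ∀ s ∈ Icc 0 T, ∀ ε ∈ Ioc 0 (T / 2), ∀ φ : EuclideanSpace ℝ (Fin d), ‖φ‖ = 1 →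
    ∃ t ∈ Icc 0 T, ε / 2 < |t - s| ∧ |t - s| < ε ∧ c * ε ^ θ < |inner ℝ φ (x t - x s)|

/-- `y` solves `y_t = a + ∑ⱼ ∫_0^t σʲ(y_u) dxʲ_u` for all `t ∈ [0,S]`, all the integrals
existing in the Young sense. -/
def SolvesOn {m d : ℕ} (σ : Fin d → EuclideanSpace ℝ (Fin m) → EuclideanSpace ℝ (Fin m))
    (x : ℝ → EuclideanSpace ℝ (Fin d)) (a : EuclideanSpace ℝ (Fin m))
    (y : ℝ → EuclideanSpace ℝ (Fin m)) (S : ℝ) : Prop :=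
  ∀ t ∈ Icc 0 S, ∃ I : Fin d → EuclideanSpace ℝ (Fin m),
    (∀ j, HasYoungIntegral (fun u => σ j (y u)) (fun u => x u j) 0 t (I j)) ∧
      y t = a + ∑ j, I j

/-- Alternative (A): the solution stays away from the origin on the whole of `[0,T]`. -/
structure NonvanishingSolution {m d : ℕ} (γ T : ℝ)
    (σ : Fin d → EuclideanSpace ℝ (Fin m) → EuclideanSpace ℝ (Fin m))
    (x : ℝ → EuclideanSpace ℝ (Fin d)) (a : EuclideanSpace ℝ (Fin m))
    (y : ℝ → EuclideanSpace ℝ (Fin m)) (τ : ℝ) : Prop where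
  tau_eq : τ = T
  ne_zero : ∀ t ∈ Icc 0 T, y t ≠ 0
  holder : IsHolderOn γ y (Icc 0 T)
  solves : SolvesOn σ x a y T

/-- Alternative (B): `y` solves the equation up to the time `τ ≤ T` at which it first hits the
origin, with a Hölder regularity that is only required on `[0,t]` for each `t < τ`, and `y`
stays at the origin from `τ` on. -/
structure AbsorbedSolution {m d : ℕ} (γ T : ℝ)
    (σ : Fin d → EuclideanSpace ℝ (Fin m) → EuclideanSpace ℝ (Fin m))
    (x : ℝ → EuclideanSpace ℝ (Fin d)) (a : EuclideanSpace ℝ (Fin m))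
    (y : ℝ → EuclideanSpace ℝ (Fin m)) (τ : ℝ) : Prop where
  tau_pos : 0 < τ
  tau_le : τ ≤ T
  holder : ∀ t, 0 ≤ t → t < τ → IsHolderOn γ y (Icc 0 t)
  solves : ∀ t, 0 ≤ t → t < τ → SolvesOn σ x a y t
  ne_zero : ∀ t ∈ Ico 0 τ, y t ≠ 0
  tendsto_zero : Tendsto y (𝓝[<] τ) (𝓝 0)
  eq_zero : ∀ t ∈ Icc τ T, y t = 0

/-! Only an absorbed solution needs an argument, and the point is a Hölder constant on `[0, τ)` that
does not blow up at `τ`. While `|y|` is comparable to `r`, the coefficients have size of order `r ^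
κ` and are Lipschitz along `y` with constant of order `r ^ (κ - 1)`. By the Young–Loève estimate,
over a time `h` with `h ^ γ` at most a small multiple of `r ^ (1 - κ)`, the Young remainder can be
absorbed and the increment of `y` is of order `r ^ κ * h ^ γ` (`SolvesOn.norm_sub_le_of_annulus`).
This is less than `r / 2`, so a path of norm `r` at one end of the interval stays in the annulus
(`norm_sub_le_of_annulus_of_endpoint`).

Hence for `s < t < τ` there is a dichotomy. If `|y| ^ (1 - κ)` is at least a large multiple of `(t -
s) ^ γ` at one endpoint, the annulus estimate applies, with `r ^ κ` bounded because `y` is.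
Otherwise both endpoint values are small, since `|y| = |y| ^ κ * |y| ^ (1 - κ)`, and the triangle
inequality suffices. Letting `t` tend to `τ` controls increments across the absorption time. -/

theorem isHolderOn_iff_dist_le {Y : Type*} [PseudoMetricSpace Y] {r : ℝ} (hr : 0 ≤ r)
    {f : ℝ → Y} {s : Set ℝ} :
    IsHolderOn r f s ↔
      ∃ C : ℝ, 0 ≤ C ∧ ∀ p ∈ s, ∀ q ∈ s, p ≤ q → dist (f p) (f q) ≤ C * (q - p) ^ r := by
  constructor
  · rintro ⟨C, hC⟩
    refine ⟨C, C.2, fun p hp q hq hpq => ?_⟩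
    have h := hC.dist_le hp hq
    rwa [Real.coe_toNNReal r hr, dist_comm p q, Real.dist_eq, abs_of_nonneg (by linarith)] at h
  · rintro ⟨C, hC0, hC⟩
    have key : ∀ p ∈ s, ∀ q ∈ s, dist (f p) (f q) ≤ C * dist p q ^ r := by
      intro p hp q hq
      rcases le_total p q with h | h
      · rw [dist_comm p q, Real.dist_eq, abs_of_nonneg (by linarith)]
        exact hC p hp q hq h
      · rw [dist_comm (f p), Real.dist_eq, abs_of_nonneg (by linarith)]
        exact hC q hq p hp h
    refine ⟨C.toNNReal, fun p hp q hq => ?_⟩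
    rw [edist_dist, edist_dist, Real.coe_toNNReal r hr,
      ENNReal.ofReal_rpow_of_nonneg dist_nonneg hr]
    change _ ≤ ENNReal.ofReal C * _
    rw [← ENNReal.ofReal_mul hC0]
    exact ENNReal.ofReal_le_ofReal (key p hp q hq)

/-! ### Concatenation of tagged partitions and dyadic partitions. -/

namespace TaggedPartition

variable {a b c : ℝ} {E : Type*}

/-- The concatenation of two tagged partitions. -/
noncomputable def append (π₁ : TaggedPartition a b) (π₂ : TaggedPartition b c) :
    TaggedPartition a c where
  n := π₁.n + π₂.n
  pt i := if i ≤ π₁.n then π₁.pt i else π₂.pt (i - π₁.n)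
  tag i := if i < π₁.n then π₁.tag i else π₂.tag (i - π₁.n)
  pt_first := by simp [π₁.pt_first]
  pt_last := by
    -- An empty second partition forces `b = c`.
    rcases Nat.eq_zero_or_pos π₂.n with h | h
    · have h1 := π₂.pt_first
      have h2 := π₂.pt_last
      rw [h] at h2
      simp [h, π₁.pt_last, ← h1, ← h2]
    · rw [if_neg (by omega), Nat.add_sub_cancel_left, π₂.pt_last]
  pt_le i hi := by
    rcases lt_trichotomy i π₁.n with h | rfl | h
    · rw [if_pos h.le, if_pos (Nat.succ_le_of_lt h)]
      exact π₁.pt_le i h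
    · have := π₂.pt_le 0 (by omega)
      simpa [π₁.pt_last, π₂.pt_first] using this
    · have := π₂.pt_le (i - π₁.n) (by omega)
      rw [if_neg (by omega), if_neg (by omega)]
      rwa [show i + 1 - π₁.n = i - π₁.n + 1 by omega]
  tag_mem i hi := by
    rcases lt_trichotomy i π₁.n with h | rfl | h
    · rw [if_pos h.le, if_pos h, if_pos (by omega)]
      exact π₁.tag_mem i h
    · have := π₂.tag_mem 0 (by omega)
      simpa [π₁.pt_last, π₂.pt_first] using this
    · have := π₂.tag_mem (i - π₁.n) (by omega)
      rw [if_neg (by omega), if_neg (by omega), if_neg (by omega)]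
      rwa [show i + 1 - π₁.n = i - π₁.n + 1 by omega]

variable (π₁ : TaggedPartition a b) (π₂ : TaggedPartition b c)

theorem append_pt_left {i : ℕ} (hi : i ≤ π₁.n) : (π₁.append π₂).pt i = π₁.pt i := if_pos hi

theorem append_pt_right (i : ℕ) : (π₁.append π₂).pt (π₁.n + i) = π₂.pt i := by
  rcases Nat.eq_zero_or_pos i with rfl | h
  · rw [append_pt_left π₁ π₂ (by simp)]
    simp [π₁.pt_last, π₂.pt_first]
  · simp [append, h.ne']

theorem append_tag_left {i : ℕ} (hi : i < π₁.n) : (π₁.append π₂).tag i = π₁.tag i := if_pos hi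

theorem append_tag_right (i : ℕ) : (π₁.append π₂).tag (π₁.n + i) = π₂.tag i := by
  simp [append]

variable {π₁ π₂} in
theorem MeshLT.append {δ : ℝ} (h₁ : π₁.MeshLT δ) (h₂ : π₂.MeshLT δ) :
    (π₁.append π₂).MeshLT δ := by
  intro i hi
  have hi' : i < π₁.n + π₂.n := hi
  rcases lt_or_ge i π₁.n with h | h
  · rw [append_pt_left _ _ h, append_pt_left _ _ h.le]
    exact h₁ i h
  · obtain ⟨k, rfl⟩ := Nat.exists_eq_add_of_le h
    rw [add_assoc, append_pt_right, append_pt_right]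
    exact h₂ k (by omega)

theorem riemannSum_append [AddCommGroup E] [Module ℝ E] (f : ℝ → E) (g : ℝ → ℝ) :
    (π₁.append π₂).riemannSum f g = π₁.riemannSum f g + π₂.riemannSum f g := by
  change ∑ i ∈ Finset.range (π₁.n + π₂.n), _ = _
  rw [Finset.sum_range_add]
  congr 1
  · refine Finset.sum_congr rfl fun i hi => ?_
    have hi := Finset.mem_range.1 hi
    rw [append_pt_left _ _ hi, append_pt_left _ _ hi.le, append_tag_left _ _ hi]
  · refine Finset.sum_congr rfl fun i _ => ?_
    rw [add_assoc, append_pt_right, append_pt_right, append_tag_right]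

/-- The partition of `[a, b]` into `N` intervals of equal length, tagged at the left ends. -/
noncomputable def uniform (hab : a ≤ b) (N : ℕ) (hN : 0 < N) : TaggedPartition a b where
  n := N
  pt i := a + (b - a) * (i / N)
  tag i := a + (b - a) * (i / N)
  pt_first := by simp
  pt_last := by
    rw [div_self (by positivity)]
    ring
  pt_le i _ := by
    have : 0 ≤ b - a := by linarith
    push_cast
    gcongr
    linarith
  tag_mem i _ := by
    have : 0 ≤ b - a := by linarith
    refine ⟨le_rfl, ?_⟩
    push_cast
    gcongr
    linarith

theorem uniform_meshLT (hab : a ≤ b) {N : ℕ} (hN : 0 < N) {δ : ℝ} (h : (b - a) / N < δ) :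
    (uniform hab N hN).MeshLT δ := by
  intro i _
  refine lt_of_eq_of_lt ?_ h
  simp only [uniform]
  push_cast
  ring

theorem eventually_uniform_two_pow_meshLT (hab : a ≤ b) {δ : ℝ} (hδ : 0 < δ) :
    ∀ᶠ n : ℕ in atTop, (uniform hab (2 ^ n) (by positivity)).MeshLT δ := by
  have h : Tendsto (fun n : ℕ => (b - a) / (2 : ℝ) ^ n) atTop (𝓝 0) :=
    tendsto_const_nhds.div_atTop (tendsto_pow_atTop_atTop_of_one_lt one_lt_two)
  filter_upwards [h.eventually (gt_mem_nhds hδ)] with n hn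
  exact uniform_meshLT hab _ (by exact_mod_cast hn)

end TaggedPartition

/-! ### The Young–Loève estimate by dyadic refinement. -/

open TaggedPartition

/-- The dyadic Riemann sums over `[b, c]` converge to the increment of the Young integral. -/
theorem HasYoungIntegral.tendsto_uniform_sub {E : Type*} [NormedAddCommGroup E] [NormedSpace ℝ E]
    {f : ℝ → E} {g : ℝ → ℝ} {a b c : ℝ} {I J : E} (hI : HasYoungIntegral f g a b I)
    (hJ : HasYoungIntegral f g a c J) (hab : a ≤ b) (hbc : b ≤ c) :
    Tendsto (fun n : ℕ => (uniform hbc (2 ^ n) (by positivity)).riemannSum f g) atTop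
      (𝓝 (J - I)) := by
  rw [Metric.tendsto_nhds]
  intro ε hε
  obtain ⟨δ₁, hδ₁, h₁⟩ := hI (ε / 2) (by positivity)
  obtain ⟨δ₂, hδ₂, h₂⟩ := hJ (ε / 2) (by positivity)
  filter_upwards [eventually_uniform_two_pow_meshLT hab hδ₁,
    eventually_uniform_two_pow_meshLT hab hδ₂,
    eventually_uniform_two_pow_meshLT hbc hδ₂] with n k₁ k₂ k₃
  have e₁ := h₁ _ k₁
  -- Additivity comes from concatenation: `A + B` is a fine Riemann sum over `[a, c]`, so `B` is
  -- close to `J - I`.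
  have e₂ := h₂ _ (k₂.append k₃)
  rw [riemannSum_append] at e₂
  set A := (uniform hab (2 ^ n) (by positivity)).riemannSum f g
  set B := (uniform hbc (2 ^ n) (by positivity)).riemannSum f g
  rw [dist_eq_norm, show B - (J - I) = (A + B - J) - (A - I) by abel]
  linarith [norm_sub_le (A + B - J) (A - I)]

theorem Finset.sum_range_two_mul {M : Type*} [AddCommMonoid M] (f : ℕ → M) (N : ℕ) :
    ∑ i ∈ Finset.range (2 * N), f i = ∑ i ∈ Finset.range N, (f (2 * i) + f (2 * i + 1)) := by
  induction N with
  | zero => simp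
  | succ N ih =>
    rw [mul_add, mul_one, Finset.sum_range_succ _ N, Finset.sum_range_succ, Finset.sum_range_succ,
      ih, add_assoc]

/-- Inserting the midpoint `Q` of `[P, R]` changes the left-point sum by `(g R - g Q) • (f Q - f
P)`. There are `2 ^ n` such terms, each of order `2 ^ (-2 * γ * n)`; the resulting ratio `2 ^ (1 - 2
* γ)` is below one once `γ > 1 / 2`. -/
theorem norm_riemannSum_uniform_succ_sub_le {E : Type*} [NormedAddCommGroup E] [NormedSpace ℝ E]
    {f : ℝ → E} {g : ℝ → ℝ} {a b γ F G : ℝ} (hγ : 0 < γ) (hab : a ≤ b) (hF0 : 0 ≤ F)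
    (hG0 : 0 ≤ G)
    (hF : ∀ p q, a ≤ p → p ≤ q → q ≤ b → ‖f q - f p‖ ≤ F * (q - p) ^ γ)
    (hG : ∀ p q, a ≤ p → p ≤ q → q ≤ b → |g q - g p| ≤ G * (q - p) ^ γ) (n : ℕ) :
    ‖(uniform hab (2 ^ (n + 1)) (by positivity)).riemannSum f g -
      (uniform hab (2 ^ n) (by positivity)).riemannSum f g‖ ≤
      F * G * ((b - a) ^ γ) ^ 2 * ((2 : ℝ) ^ (1 - 2 * γ)) ^ n := by
  have hba : 0 ≤ b - a := by linarith
  have e : (uniform hab (2 ^ (n + 1)) (by positivity)).riemannSum f g =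
      ∑ i ∈ Finset.range (2 * 2 ^ n),
        (g (a + (b - a) * (((i + 1 : ℕ) : ℝ) / ((2 ^ (n + 1) : ℕ) : ℝ))) -
          g (a + (b - a) * ((i : ℝ) / ((2 ^ (n + 1) : ℕ) : ℝ)))) •
          f (a + (b - a) * ((i : ℝ) / ((2 ^ (n + 1) : ℕ) : ℝ))) := by
    simp only [riemannSum, uniform, pow_succ']
  rw [e, Finset.sum_range_two_mul]
  simp only [riemannSum, uniform]
  rw [← Finset.sum_sub_distrib]
  have hterm : ∀ i ∈ Finset.range (2 ^ n), ‖((g (a + (b - a) *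
      (((2 * i + 1 : ℕ) : ℝ) / ((2 ^ (n + 1) : ℕ) : ℝ))) -
          g (a + (b - a) * (((2 * i : ℕ) : ℝ) / ((2 ^ (n + 1) : ℕ) : ℝ)))) •
          f (a + (b - a) * (((2 * i : ℕ) : ℝ) / ((2 ^ (n + 1) : ℕ) : ℝ))) +
        (g (a + (b - a) * (((2 * i + 1 + 1 : ℕ) : ℝ) / ((2 ^ (n + 1) : ℕ) : ℝ))) -
          g (a + (b - a) * (((2 * i + 1 : ℕ) : ℝ) / ((2 ^ (n + 1) : ℕ) : ℝ)))) •
          f (a + (b - a) * (((2 * i + 1 : ℕ) : ℝ) / ((2 ^ (n + 1) : ℕ) : ℝ)))) -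
        (g (a + (b - a) * (((i + 1 : ℕ) : ℝ) / ((2 ^ n : ℕ) : ℝ))) -
          g (a + (b - a) * ((i : ℝ) / ((2 ^ n : ℕ) : ℝ)))) •
          f (a + (b - a) * ((i : ℝ) / ((2 ^ n : ℕ) : ℝ)))‖ ≤
        F * G * ((b - a) ^ γ) ^ 2 * (((1 / 2 : ℝ) ^ n) ^ γ) ^ 2 := by
    intro i hi
    have hi : (i : ℝ) + 1 ≤ 2 ^ n := by exact_mod_cast Finset.mem_range.1 hi
    set P := a + (b - a) * ((i : ℝ) / ((2 ^ n : ℕ) : ℝ)) with hP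
    set R := a + (b - a) * (((i + 1 : ℕ) : ℝ) / ((2 ^ n : ℕ) : ℝ)) with hR
    set Q := a + (b - a) * (((2 * i + 1 : ℕ) : ℝ) / ((2 ^ (n + 1) : ℕ) : ℝ)) with hQ
    have e1 : a + (b - a) * (((2 * i : ℕ) : ℝ) / ((2 ^ (n + 1) : ℕ) : ℝ)) = P := by
      rw [hP]; push_cast; field_simp; ring
    have e2 : a + (b - a) * (((2 * i + 1 + 1 : ℕ) : ℝ) / ((2 ^ (n + 1) : ℕ) : ℝ)) = R := by
      rw [hR]; push_cast; field_simp; ring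
    rw [e1, e2]
    have hPQ : Q - P = (b - a) * (1 / 2) ^ n / 2 := by
      rw [hP, hQ]; push_cast; rw [one_div_pow]; field_simp; ring
    have hQR : R - Q = (b - a) * (1 / 2) ^ n / 2 := by
      rw [hR, hQ]; push_cast; rw [one_div_pow]; field_simp; ring
    have hh : 0 ≤ (b - a) * (1 / 2 : ℝ) ^ n := by positivity
    have haP : a ≤ P := by
      rw [hP]
      linarith [mul_nonneg hba (show (0 : ℝ) ≤ i / (2 ^ n : ℕ) by positivity)]
    have hRb : R ≤ b := by
      have : (((i + 1 : ℕ) : ℝ) / ((2 ^ n : ℕ) : ℝ)) ≤ 1 := by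
        push_cast
        exact (div_le_one (by positivity)).2 hi
      rw [hR]
      nlinarith
    have hf := hF P Q haP (by linarith) (by linarith)
    have hg := hG Q R (by linarith) (by linarith) hRb
    -- The gain from the half-length is discarded, which only costs a constant.
    have hpow : ((b - a) * (1 / 2 : ℝ) ^ n / 2) ^ γ ≤ (b - a) ^ γ * ((1 / 2 : ℝ) ^ n) ^ γ := by
      rw [← Real.mul_rpow hba (by positivity)]
      exact Real.rpow_le_rpow (by linarith) (by linarith) hγ.le
    rw [hPQ] at hf
    rw [hQR] at hg
    have : (g Q - g P) • f P + (g R - g Q) • f Q - (g R - g P) • f P =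
        (g R - g Q) • (f Q - f P) := by module
    rw [this, norm_smul, Real.norm_eq_abs]
    calc |g R - g Q| * ‖f Q - f P‖ ≤ (G * ((b - a) ^ γ * ((1 / 2 : ℝ) ^ n) ^ γ)) *
          (F * ((b - a) ^ γ * ((1 / 2 : ℝ) ^ n) ^ γ)) := by
            gcongr
            · exact hg.trans (by gcongr)
            · exact hf.trans (by gcongr)
      _ = _ := by ring
  refine (norm_sum_le_of_le _ hterm).trans (le_of_eq ?_)
  rw [Finset.sum_const, Finset.card_range, nsmul_eq_mul]
  have e3 : (2 : ℝ) ^ (1 - 2 * γ) = 2 * ((1 / 2 : ℝ) ^ γ) ^ 2 := by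
    rw [Real.rpow_sub two_pos, Real.rpow_one, one_div, Real.inv_rpow two_pos.le, mul_comm 2 γ,
      Real.rpow_mul two_pos.le]
    norm_num
    rfl
  have e4 : ((1 / 2 : ℝ) ^ n) ^ γ = ((1 / 2 : ℝ) ^ γ) ^ n := by
    rw [← Real.rpow_natCast, ← Real.rpow_mul (by norm_num), mul_comm,
      Real.rpow_mul (by norm_num), Real.rpow_natCast]
  rw [e3, e4, mul_pow]
  push_cast
  ring

/-- The Young–Loève estimate. -/
theorem HasYoungIntegral.norm_sub_sub_le {E : Type*} [NormedAddCommGroup E] [NormedSpace ℝ E]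
    {f : ℝ → E} {g : ℝ → ℝ} {a b c γ F G : ℝ} {I J : E} (hI : HasYoungIntegral f g a b I)
    (hJ : HasYoungIntegral f g a c J) (hab : a ≤ b) (hbc : b ≤ c) (hγ : 1 / 2 < γ)
    (hF0 : 0 ≤ F) (hG0 : 0 ≤ G)
    (hF : ∀ p q, b ≤ p → p ≤ q → q ≤ c → ‖f q - f p‖ ≤ F * (q - p) ^ γ)
    (hG : ∀ p q, b ≤ p → p ≤ q → q ≤ c → |g q - g p| ≤ G * (q - p) ^ γ) :
    ‖J - I - (g c - g b) • f b‖ ≤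
      F * G * ((c - b) ^ γ) ^ 2 * (1 - (2 : ℝ) ^ (1 - 2 * γ))⁻¹ := by
  set S := fun n : ℕ => (uniform hbc (2 ^ n) (by positivity)).riemannSum f g with hS
  set ρ := (2 : ℝ) ^ (1 - 2 * γ) with hρ
  have hρ0 : 0 ≤ ρ := by positivity
  have hρ1 : ρ < 1 := Real.rpow_lt_one_of_one_lt_of_neg one_lt_two (by linarith)
  have hS0 : S 0 = (g c - g b) • f b := by simp [hS, riemannSum, uniform]
  have hlim := hI.tendsto_uniform_sub hJ hab hbc
  have := dist_le_of_le_geometric_of_tendsto₀ ρ (F * G * ((c - b) ^ γ) ^ 2) hρ1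
    (f := S) (fun n => by
      rw [dist_comm, dist_eq_norm]
      exact norm_riemannSum_uniform_succ_sub_le (by linarith) hbc hF0 hG0 hF hG n) hlim
  rwa [dist_comm, dist_eq_norm, hS0, div_eq_mul_inv] at this

/-! ### Analytic tools: powers away from zero, absorption, and confinement to an annulus. -/

theorem Real.abs_rpow_sub_rpow_le {κ r u v : ℝ} (hκ0 : 0 ≤ κ) (hκ1 : κ ≤ 1) (hr : 0 < r)
    (hu : r ≤ u) (hv : r ≤ v) : |u ^ κ - v ^ κ| ≤ r ^ (κ - 1) * |u - v| := by
  wlog huv : v ≤ u generalizing u v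
  · rw [abs_sub_comm, abs_sub_comm u]
    exact this hv hu (le_of_not_ge huv)
  have hv0 : 0 < v := hr.trans_le hv
  have hu0 : 0 < u := hr.trans_le hu
  rw [abs_of_nonneg (sub_nonneg.2 (Real.rpow_le_rpow hv0.le huv hκ0)),
    abs_of_nonneg (sub_nonneg.2 huv)]
  have h1 : v ^ (κ - 1) ≤ r ^ (κ - 1) := Real.rpow_le_rpow_of_nonpos hr hv (by linarith)
  have h2 : u ^ (κ - 1) ≤ v ^ (κ - 1) := Real.rpow_le_rpow_of_nonpos hv0 huv (by linarith)
  have h3 : ∀ w : ℝ, 0 < w → w ^ κ = w ^ (κ - 1) * w := fun w hw => by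
    rw [Real.rpow_sub_one hw.ne']; field_simp
  rw [h3 u hu0, h3 v hv0]
  nlinarith

/-- The absorption argument for Hölder seminorms. -/
theorem norm_sub_le_of_holder_bound_improves {E : Type*} [SeminormedAddCommGroup E] {y : ℝ → E}
    {s t γ A H : ℝ} (hA : 0 ≤ A) (hH : 0 ≤ H)
    (h₀ : ∀ p q, s ≤ p → p ≤ q → q ≤ t → ‖y q - y p‖ ≤ H * (q - p) ^ γ)
    (h : ∀ H, 0 ≤ H → (∀ p q, s ≤ p → p ≤ q → q ≤ t → ‖y q - y p‖ ≤ H * (q - p) ^ γ) →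
      ∀ p q, s ≤ p → p ≤ q → q ≤ t → ‖y q - y p‖ ≤ (A + H / 2) * (q - p) ^ γ)
    {p q : ℝ} (hp : s ≤ p) (hpq : p ≤ q) (hq : q ≤ t) :
    ‖y q - y p‖ ≤ 2 * A * (q - p) ^ γ := by
  -- The map `H ↦ A + H / 2` fixes `2 * A` and halves the excess over it, so the initial constant
  -- `H` disappears in the limit.
  have key : ∀ n : ℕ, ∀ p q, s ≤ p → p ≤ q → q ≤ t →
      ‖y q - y p‖ ≤ (2 * A + H * (1 / 2) ^ n) * (q - p) ^ γ := by
    intro n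
    induction n with
    | zero =>
      intro p q hp hpq hq
      have : 0 ≤ (q - p) ^ γ := Real.rpow_nonneg (by linarith) _
      nlinarith [h₀ p q hp hpq hq]
    | succ n ih =>
      intro p q hp hpq hq
      refine (h _ (by positivity) ih p q hp hpq hq).trans (le_of_eq ?_)
      ring
  have hl : Tendsto (fun n : ℕ => (2 * A + H * (1 / 2 : ℝ) ^ n) * (q - p) ^ γ) atTop
      (𝓝 ((2 * A + H * 0) * (q - p) ^ γ)) :=
    (((tendsto_pow_atTop_nhds_zero_of_lt_one (by norm_num) (by norm_num)).const_mul H).const_add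
      (2 * A)).mul_const _
  simpa using ge_of_tendsto' hl fun n => key n p q hp hpq hq

/-- Continuity bootstrap: at the first time `ψ` reaches `ρ`, the bound `ψ ≤ ρ` holds up to that
time, so the hypothesis makes it strict there, a contradiction. -/
theorem ContinuousOn.le_of_forall_lt_of_forall_le {ψ : ℝ → ℝ} {s t ρ : ℝ}
    (hψ : ContinuousOn ψ (Icc s t)) (hs : ψ s < ρ)
    (h : ∀ v ∈ Icc s t, (∀ w ∈ Icc s v, ψ w ≤ ρ) → ψ v < ρ) : ∀ v ∈ Icc s t, ψ v ≤ ρ := by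
  by_contra! hcon
  obtain ⟨u, hu, huρ⟩ := hcon
  have hcpt : IsCompact (Icc s t ∩ ψ ⁻¹' Ici ρ) :=
    isCompact_Icc.of_isClosed_subset (hψ.preimage_isClosed_of_isClosed isClosed_Icc isClosed_Ici)
      inter_subset_left
  obtain ⟨v, ⟨hv, hvρ⟩, hmin⟩ := hcpt.exists_isLeast ⟨u, hu, huρ.le⟩
  have hlt : ∀ w ∈ Icc s v, ψ w = ρ → w = v := fun w hw e =>
    le_antisymm hw.2 (hmin ⟨⟨hw.1, hw.2.trans hv.2⟩, e.ge⟩)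
  have hveq : ψ v ≤ ρ := by
    obtain ⟨w, hw, hwρ⟩ := intermediate_value_Icc hv.1 (hψ.mono (Icc_subset_Icc_right hv.2))
      ⟨hs.le, hvρ⟩
    rw [← hlt w hw hwρ, hwρ]
  refine (h v hv fun w hw => ?_).not_ge hvρ
  by_contra! hw'
  have : w = v := le_antisymm hw.2 (hmin ⟨⟨hw.1, hw.2.trans hv.2⟩, hw'.le⟩)
  exact (this ▸ hw').not_ge hveq

/-- A path that obeys a Hölder estimate as long as it stays in the annulus
`r / 2 ≤ |ξ| ≤ 2 r`, and that has norm `r` at one end of a short interval, obeys this estimate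
on the interval. -/
theorem norm_sub_le_of_annulus_of_endpoint {E : Type*} [SeminormedAddCommGroup E] {y : ℝ → E}
    {s t γ r B : ℝ} (hγ : 0 ≤ γ) (hst : s ≤ t) (hy : ContinuousOn y (Icc s t)) (hr : 0 < r)
    (hB : 0 ≤ B)
    (hloc : ∀ v w, s ≤ v → v ≤ w → w ≤ t → (∀ u ∈ Icc v w, r / 2 ≤ ‖y u‖ ∧ ‖y u‖ ≤ 2 * r) →
      ‖y w - y v‖ ≤ B * (w - v) ^ γ)
    (hsmall : B * (t - s) ^ γ < r / 2) (hend : ‖y s‖ = r ∨ ‖y t‖ = r) :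
    ‖y t - y s‖ ≤ B * (t - s) ^ γ := by
  have hann : ∀ u η : E, ‖η‖ = r → ‖u - η‖ ≤ r / 2 → r / 2 ≤ ‖u‖ ∧ ‖u‖ ≤ 2 * r := by
    intro u η hη h
    have h1 := norm_sub_norm_le η u
    have h2 := norm_sub_norm_le u η
    rw [norm_sub_rev] at h1
    constructor <;> linarith
  have hmono : ∀ v w, s ≤ v → v ≤ w → w ≤ t → B * (w - v) ^ γ < r / 2 := by
    intro v w hv hvw hw
    refine lt_of_le_of_lt ?_ hsmall
    have : 0 ≤ w - v := by linarith
    gcongr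
  refine hloc s t le_rfl hst le_rfl fun u hu => ?_
  rcases hend with h | h
  · refine hann _ _ h (ContinuousOn.le_of_forall_lt_of_forall_le (ψ := fun u => ‖y u - y s‖)
      (by fun_prop) (by simpa using hr) (fun v hv hw => ?_) u hu)
    exact (hloc s v le_rfl hv.1 hv.2 fun w hw' => hann _ _ h (hw w hw')).trans_lt
      (hmono s v le_rfl hv.1 hv.2)
  -- When the norm is known at `t`, the bootstrap runs backwards in time.
  · have hrefl : MapsTo (fun u => s + t - u) (Icc s t) (Icc s t) := fun u hu =>
      ⟨by linarith [hu.2], by linarith [hu.1]⟩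
    have hc : ContinuousOn (fun u => y (s + t - u)) (Icc s t) :=
      hy.comp (by fun_prop) hrefl
    have := ContinuousOn.le_of_forall_lt_of_forall_le (ψ := fun u => ‖y (s + t - u) - y t‖)
      (ρ := r / 2) (by fun_prop) (by simpa using hr) (fun v hv hw => ?_) _ (hrefl hu)
    · exact hann _ _ h (by simpa using this)
    · have hv' := hrefl hv
      refine lt_of_le_of_lt ?_ (hmono (s + t - v) t hv'.1 hv'.2 le_rfl)
      rw [norm_sub_rev]
      refine hloc _ _ hv'.1 hv'.2 le_rfl fun w hw' => hann _ _ h ?_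
      simpa using hw (s + t - w) ⟨by linarith [hw'.2], by linarith [hw'.1]⟩

/-! ### Hölder estimates for solutions. -/

/-- The Hölder estimate for a solution which stays in the annulus `r / 2 ≤ |ξ| ≤ 2 r` during a
short time interval. -/
theorem SolvesOn.norm_sub_le_of_annulus {m d : ℕ} {γ κ C L S s t r H : ℝ}
    {σ : Fin d → EuclideanSpace ℝ (Fin m) → EuclideanSpace ℝ (Fin m)}
    {x : ℝ → EuclideanSpace ℝ (Fin d)} {a : EuclideanSpace ℝ (Fin m)}
    {y : ℝ → EuclideanSpace ℝ (Fin m)} (hsol : SolvesOn σ x a y S)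
    (hγ : 1 / 2 < γ) (hκ0 : 0 < κ) (hκ1 : κ < 1) (hC : 0 ≤ C) (hL : 0 ≤ L)
    (hσ0 : ∀ j, σ j 0 = 0)
    (hσ : ∀ j ξ₁ ξ₂, ‖σ j ξ₂ - σ j ξ₁‖ ≤ C * |‖ξ₂‖ ^ κ - ‖ξ₁‖ ^ κ|)
    (hs : 0 ≤ s) (hst : s ≤ t) (ht : t ≤ S)
    (hx : ∀ p q, s ≤ p → p ≤ q → q ≤ t → ‖x q - x p‖ ≤ L * (q - p) ^ γ)
    (hH : 0 ≤ H) (hyH : ∀ p q, s ≤ p → p ≤ q → q ≤ t → ‖y q - y p‖ ≤ H * (q - p) ^ γ)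
    (hr : 0 < r) (hann : ∀ u ∈ Icc s t, r / 2 ≤ ‖y u‖ ∧ ‖y u‖ ≤ 2 * r)
    (hsmall : 4 * (d * C * L) * (1 - (2 : ℝ) ^ (1 - 2 * γ))⁻¹ * (t - s) ^ γ ≤ r ^ (1 - κ)) :
    ‖y t - y s‖ ≤ 4 * (d * C * L) * r ^ κ * (t - s) ^ γ := by
  set K := (1 - (2 : ℝ) ^ (1 - 2 * γ))⁻¹ with hK
  have hK0 : 0 ≤ K := inv_nonneg.2 (sub_nonneg.2
    (Real.rpow_le_one_of_one_le_of_nonpos one_le_two (by linarith)))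
  have htwo : (2 : ℝ) ^ κ ≤ 2 := by
    simpa using Real.rpow_le_rpow_of_exponent_le one_le_two hκ1.le
  have hrκ : 0 < r ^ (κ - 1) := Real.rpow_pos_of_pos hr _
  have hhalf : (r / 2) ^ (κ - 1) ≤ 2 * r ^ (κ - 1) := by
    rw [Real.div_rpow hr.le two_pos.le, Real.rpow_sub_one two_ne_zero, div_div_eq_mul_div,
      div_le_iff₀ (by positivity)]
    have : 1 ≤ (2 : ℝ) ^ κ := Real.one_le_rpow one_le_two hκ0.le
    nlinarith
  have hfin := norm_sub_le_of_holder_bound_improves (y := y) (γ := γ) (s := s) (t := t)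
    (A := 2 * (d * C * L) * r ^ κ) (by positivity) hH hyH ?_ le_rfl hst le_rfl
  · exact hfin.trans (le_of_eq (by ring))
  intro H hH hyH p q hp hpq hq
  obtain ⟨I, hI, hyp⟩ := hsol p ⟨by linarith, by linarith⟩
  obtain ⟨J, hJ, hyq⟩ := hsol q ⟨by linarith, by linarith⟩
  have hqp : 0 ≤ q - p := by linarith
  set h := (q - p) ^ γ with hh
  have hh0 : 0 ≤ h := Real.rpow_nonneg hqp _
  have hhle : h ≤ (t - s) ^ γ := Real.rpow_le_rpow hqp (by linarith) (by linarith)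
  have hxj : ∀ j u v, p ≤ u → u ≤ v → v ≤ q → |x v j - x u j| ≤ L * (v - u) ^ γ := by
    intro j u v hu huv hv
    refine le_trans ?_ (hx u v (hp.trans hu) huv (hv.trans hq))
    simpa using PiLp.norm_apply_le (x v - x u) j
  have hterm : ∀ j ∈ Finset.univ, ‖J j - I j‖ ≤
      C * L * (2 * r ^ κ + 2 * r ^ (κ - 1) * H * h * K) * h := by
    intro j _
    -- The lower bound `r / 2` on the norms makes the power function Lipschitz with constant `2 * r
    -- ^ (κ - 1)`.
    have hf : ∀ u v, p ≤ u → u ≤ v → v ≤ q →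
        ‖σ j (y v) - σ j (y u)‖ ≤ C * (2 * r ^ (κ - 1)) * H * (v - u) ^ γ := by
      intro u v hu huv hv
      have hu' := hann u ⟨hp.trans hu, (huv.trans hv).trans hq⟩
      have hv' := hann v ⟨(hp.trans hu).trans huv, hv.trans hq⟩
      have hn := hyH u v (hp.trans hu) huv (hv.trans hq)
      have h1 := Real.abs_rpow_sub_rpow_le hκ0.le hκ1.le (half_pos hr) hv'.1 hu'.1
      calc _ ≤ C * |‖y v‖ ^ κ - ‖y u‖ ^ κ| := hσ j _ _
        _ ≤ C * ((2 * r ^ (κ - 1)) * (H * (v - u) ^ γ)) := by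
          gcongr
          refine h1.trans ?_
          gcongr
          exact (abs_norm_sub_norm_le _ _).trans hn
        _ = _ := by ring
    have hY := (hI j).norm_sub_sub_le (hJ j) (by linarith) hpq hγ (by positivity) hL hf (hxj j)
    have hσp : ‖σ j (y p)‖ ≤ C * (2 * r ^ κ) := by
      have h1 := hσ j 0 (y p)
      rw [hσ0, sub_zero, norm_zero, Real.zero_rpow hκ0.ne', sub_zero,
        abs_of_nonneg (by positivity)] at h1
      refine h1.trans ?_
      gcongr
      calc ‖y p‖ ^ κ ≤ (2 * r) ^ κ :=
            Real.rpow_le_rpow (norm_nonneg _) (hann p ⟨hp, hpq.trans hq⟩).2 hκ0.le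
        _ = 2 ^ κ * r ^ κ := Real.mul_rpow two_pos.le hr.le
        _ ≤ _ := by gcongr
    have hmain : ‖(x q j - x p j) • σ j (y p)‖ ≤ L * h * (C * (2 * r ^ κ)) := by
      rw [norm_smul, Real.norm_eq_abs]
      exact mul_le_mul (hxj j p q le_rfl hpq le_rfl) hσp (norm_nonneg _) (by positivity)
    have htri := norm_add_le (J j - I j - (x q j - x p j) • σ j (y p))
      ((x q j - x p j) • σ j (y p))
    rw [sub_add_cancel] at htri
    calc _ ≤ _ := htri
      _ ≤ _ := add_le_add hY hmain
      _ = _ := by ring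
  have hsum : y q - y p = ∑ j, (J j - I j) := by
    rw [hyp, hyq, Finset.sum_sub_distrib]; abel
  rw [hsum]
  refine (norm_sum_le_of_le _ hterm).trans ?_
  rw [Finset.sum_const, Finset.card_univ, Fintype.card_fin, nsmul_eq_mul]
  have hone : r ^ (κ - 1) * r ^ (1 - κ) = 1 := by
    rw [← Real.rpow_add hr]; simp
  -- The time scale is chosen to offset `r ^ (κ - 1)`: the Young remainders then contribute at most
  -- `H / 2` to the Hölder constant, as absorption requires.
  have habs : 4 * (d * C * L) * K * r ^ (κ - 1) * h ≤ 1 := by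
    calc _ ≤ 4 * (d * C * L) * K * r ^ (κ - 1) * (t - s) ^ γ := by gcongr
      _ = r ^ (κ - 1) * (4 * (d * C * L) * K * (t - s) ^ γ) := by ring
      _ ≤ r ^ (κ - 1) * r ^ (1 - κ) := mul_le_mul_of_nonneg_left hsmall hrκ.le
      _ = 1 := hone
  calc _ = (2 * (d * C * L) * r ^ κ + (4 * (d * C * L) * K * r ^ (κ - 1) * h) * (H / 2)) * h := by
        ring
    _ ≤ (2 * (d * C * L) * r ^ κ + 1 * (H / 2)) * h := by gcongr
    _ = _ := by ring

theorem ExtraRegular.exists_norm_sub_le {γ κ T : ℝ} {d : ℕ} {x : ℝ → EuclideanSpace ℝ (Fin d)}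
    (hx : ExtraRegular γ κ T x) (hγ : 0 < γ) (hT : 0 ≤ T) :
    ∃ L : ℝ, 0 ≤ L ∧ ∀ p q, 0 ≤ p → p ≤ q → q ≤ T → ‖x q - x p‖ ≤ L * (q - p) ^ γ := by
  obtain ⟨ε, hε, hx, -⟩ := hx
  obtain ⟨L, hL, h⟩ := (isHolderOn_iff_dist_le (by linarith)).1 hx
  refine ⟨L * T ^ ε, by positivity, fun p q hp hpq hq => ?_⟩
  have h1 := h p ⟨hp, hpq.trans hq⟩ q ⟨hp.trans hpq, hq⟩ hpq
  rw [dist_comm, dist_eq_norm] at h1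
  have hqp : 0 ≤ q - p := by linarith
  calc _ ≤ _ := h1
    _ = L * (q - p) ^ ε * (q - p) ^ γ := by
      rw [Real.rpow_add_of_nonneg hqp hγ.le hε.le]; ring
    _ ≤ _ := by
      gcongr
      linarith

theorem PowerHolder.exists_uniform_bound {γ κ : ℝ} {m d : ℕ}
    {σ : Fin d → EuclideanSpace ℝ (Fin m) → EuclideanSpace ℝ (Fin m)}
    (hσ : ∀ j, PowerHolder γ κ (σ j)) :
    ∃ C : ℝ, 0 ≤ C ∧ ∀ j ξ₁ ξ₂, ‖σ j ξ₂ - σ j ξ₁‖ ≤ C * |‖ξ₂‖ ^ κ - ‖ξ₁‖ ^ κ| := by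
  choose C hC using fun j => (hσ j).bound
  refine ⟨∑ j, |C j|, by positivity, fun j ξ₁ ξ₂ => (hC j ξ₁ ξ₂).trans ?_⟩
  gcongr
  exact (le_abs_self _).trans
    (Finset.single_le_sum (f := fun j => |C j|) (fun _ _ => abs_nonneg _) (Finset.mem_univ j))

/-- A solution absorbed at the origin is Hölder continuous, uniformly up to the absorption
time. -/
theorem AbsorbedSolution.exists_norm_sub_le {m d : ℕ} {γ κ T τ : ℝ}
    {σ : Fin d → EuclideanSpace ℝ (Fin m) → EuclideanSpace ℝ (Fin m)}
    {x : ℝ → EuclideanSpace ℝ (Fin d)} {a : EuclideanSpace ℝ (Fin m)}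
    {y : ℝ → EuclideanSpace ℝ (Fin m)} (hy : AbsorbedSolution γ T σ x a y τ)
    (hγ : 1 / 2 < γ) (hκ0 : 0 < κ) (hκ1 : κ < 1)
    (hσ : ∀ j, PowerHolder γ κ (σ j)) (hx : ExtraRegular γ κ T x)
    (hcont : ContinuousOn y (Icc 0 T)) :
    ∃ Q : ℝ, 0 ≤ Q ∧ ∀ s t, 0 ≤ s → s < t → t < τ → ‖y t - y s‖ ≤ Q * (t - s) ^ γ := by
  have hT : 0 < T := hy.tau_pos.trans_le hy.tau_le
  obtain ⟨L, hL, hxL⟩ := hx.exists_norm_sub_le (by linarith) hT.le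
  obtain ⟨C, hC, hσC⟩ := PowerHolder.exists_uniform_bound hσ
  obtain ⟨M, hM⟩ := isCompact_Icc.exists_bound_of_continuousOn hcont
  have hM0 : 0 ≤ M := (norm_nonneg _).trans (hM 0 ⟨le_rfl, hT.le⟩)
  set K := (1 - (2 : ℝ) ^ (1 - 2 * γ))⁻¹ with hK
  have hK0 : 0 ≤ K := inv_nonneg.2 (sub_nonneg.2
    (Real.rpow_le_one_of_one_le_of_nonpos one_le_two (by linarith)))
  set D : ℝ := d * C * L with hD
  have hD0 : 0 ≤ D := by positivity
  -- `N` dominates `4 * D * K`, for the absorption, and strictly exceeds `8 * D`, so that the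
  -- displacement stays below `r / 2`; the `+ 1` gives strictness even if `D = 0`.
  set N : ℝ := 8 * D * (K + 1) + 1 with hN
  refine ⟨4 * D * M ^ κ + 2 * (M ^ κ * N), by positivity, fun s t hs hst ht => ?_⟩
  have hts : 0 < t - s := by linarith
  have hh : 0 < (t - s) ^ γ := Real.rpow_pos_of_pos hts _
  have htT : t ≤ T := ht.le.trans hy.tau_le
  have hMκ : 0 ≤ M ^ κ := by positivity
  have hmem : ∀ p, p = s ∨ p = t → p ∈ Icc s t := by
    rintro p (rfl | rfl)
    exacts [⟨le_rfl, hst.le⟩, ⟨hst.le, le_rfl⟩]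
  by_cases hnear : ∃ p, (p = s ∨ p = t) ∧ N * (t - s) ^ γ ≤ ‖y p‖ ^ (1 - κ)
  · obtain ⟨p, hp, hle⟩ := hnear
    have hpI := hmem p hp
    set r := ‖y p‖ with hrdef
    have hr : 0 < r := norm_pos_iff.2 (hy.ne_zero p ⟨hs.trans hpI.1, hpI.2.trans_lt ht⟩)
    have hrM : r ^ κ ≤ M ^ κ :=
      Real.rpow_le_rpow hr.le (hM p ⟨hs.trans hpI.1, hpI.2.trans htT⟩) hκ0.le
    have hrr : r ^ κ * r ^ (1 - κ) = r := by rw [← Real.rpow_add hr]; simp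
    have hrκ : 0 < r ^ κ := Real.rpow_pos_of_pos hr _
    -- `H` depends on `t` and may blow up at `τ`; it only starts the absorption and does not enter
    -- the bound.
    obtain ⟨H, hH, hyH⟩ := (isHolderOn_iff_dist_le (by linarith)).1
      (hy.holder t (hs.trans hst.le) ht)
    have hDK : 0 ≤ D * K := by positivity
    have hest : ‖y t - y s‖ ≤ 4 * D * r ^ κ * (t - s) ^ γ := by
      refine norm_sub_le_of_annulus_of_endpoint (by linarith) hst.le
        (hcont.mono (Icc_subset_Icc hs htT)) hr (by positivity) (fun v w hv hvw hw hann => ?_) ?_ ?_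
      · have hsub : ∀ p q, v ≤ p → p ≤ q → q ≤ w → ‖y q - y p‖ ≤ H * (q - p) ^ γ := by
          intro p q hp hpq hq
          rw [← dist_eq_norm, dist_comm]
          exact hyH p ⟨by linarith, by linarith⟩ q ⟨by linarith, by linarith⟩ hpq
        refine (hy.solves t (hs.trans hst.le) ht).norm_sub_le_of_annulus hγ hκ0 hκ1 hC hL
          (fun j => (hσ j).map_zero) hσC (hs.trans hv) hvw hw
          (fun p q hp hpq hq => hxL p q (by linarith) hpq (by linarith)) hH hsub hr hann ?_
        have hwv : 0 ≤ w - v := by linarith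
        calc _ ≤ 4 * D * K * (t - s) ^ γ := by gcongr
          _ ≤ N * (t - s) ^ γ := by
            gcongr
            rw [hN]
            nlinarith
          _ ≤ _ := hle
      · have h8 : 8 * D * (t - s) ^ γ < r ^ (1 - κ) := by
          refine lt_of_lt_of_le ?_ hle
          gcongr
          rw [hN]
          nlinarith
        calc _ = r ^ κ * (8 * D * (t - s) ^ γ) / 2 := by ring
          _ < r ^ κ * r ^ (1 - κ) / 2 := by gcongr
          _ = _ := by rw [hrr]
      · rcases hp with rfl | rfl
        exacts [Or.inl rfl, Or.inr rfl]
    refine hest.trans ?_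
    gcongr
    have : 0 ≤ M ^ κ * N := by positivity
    nlinarith
  -- Both endpoint values are now small compared with the time step, so no cancellation between them
  -- is needed.
  · push Not at hnear
    have hbd : ∀ p, p = s ∨ p = t → ‖y p‖ ≤ M ^ κ * N * (t - s) ^ γ := by
      intro p hp
      have hpI := hmem p hp
      have hr : 0 < ‖y p‖ := norm_pos_iff.2 (hy.ne_zero p ⟨hs.trans hpI.1, hpI.2.trans_lt ht⟩)
      have hrM : ‖y p‖ ^ κ ≤ M ^ κ :=
        Real.rpow_le_rpow hr.le (hM p ⟨hs.trans hpI.1, hpI.2.trans htT⟩) hκ0.le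
      calc ‖y p‖ = ‖y p‖ ^ κ * ‖y p‖ ^ (1 - κ) := by rw [← Real.rpow_add hr]; simp
        _ ≤ M ^ κ * (N * (t - s) ^ γ) := by
          gcongr
          exact (hnear p hp).le
        _ = _ := by ring
    have h1 := hbd s (Or.inl rfl)
    have h2 := hbd t (Or.inr rfl)
    have h3 := norm_sub_le (y t) (y s)
    have h4 : 0 ≤ 4 * D * M ^ κ * (t - s) ^ γ := by positivity
    nlinarith

theorem mainTheorem5 (m d : ℕ) (γ κ T : ℝ) (hγ : 1 / 2 < γ) (hγ1 : γ < 1) (hT : 0 < T)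
    (a : EuclideanSpace ℝ (Fin m)) (ha : a ≠ 0)
    (σ : Fin d → EuclideanSpace ℝ (Fin m) → EuclideanSpace ℝ (Fin m))
    (hσ : ∀ j, PowerType γ κ (σ j))
    (x : ℝ → EuclideanSpace ℝ (Fin d))
    (hx : ExtraRegular γ κ T x)
    (hrough : ∃ ε > 0, HolderRough (γ + ε) T x)
    (hγκ : 1 < γ + κ)
    (y : ℝ → EuclideanSpace ℝ (Fin m)) (τ : ℝ)
    (hcont : ContinuousOn y (Icc 0 T))
    (hy : NonvanishingSolution γ T σ x a y τ ∨ AbsorbedSolution γ T σ x a y τ) :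
    IsHolderOn γ y (Icc 0 T) := by
  rcases hy with hy | hy
  · exact hy.holder
  -- The range of `κ` is read off from the exponent conditions, since `d = 0` is allowed and then
  -- `hσ` says nothing.
  have hκ0 : 0 < κ := by linarith
  have hκ1 : κ < 1 := by
    obtain ⟨ε, hε, -, h⟩ := hx
    by_contra! hκ
    nlinarith
  obtain ⟨Q, hQ, hyQ⟩ := hy.exists_norm_sub_le hγ hκ0 hκ1
    (fun j => (hσ j).toPowerHolder) hx hcont
  have h0 : 0 ≤ γ := by linarith
  -- The decay rate at absorption follows from `t ↑ τ` and bounds increments across `τ`, because `τ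
  -- - s ≤ t - s` when `t ≥ τ`.
  have hτ : ∀ s, 0 ≤ s → s < τ → ‖y s‖ ≤ Q * (τ - s) ^ γ := by
    intro s hs hsτ
    have hl : Tendsto (fun t => ‖y t - y s‖) (𝓝[<] τ) (𝓝 ‖0 - y s‖) :=
      (hy.tendsto_zero.sub_const _).norm
    have hr : Tendsto (fun t => Q * (t - s) ^ γ) (𝓝[<] τ) (𝓝 (Q * (τ - s) ^ γ)) := by
      have : Continuous fun t : ℝ => Q * (t - s) ^ γ :=
        continuous_const.mul ((continuous_id.sub continuous_const).rpow_const fun _ => Or.inr h0)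
      exact (this.tendsto τ).mono_left nhdsWithin_le_nhds
    have hle := le_of_tendsto_of_tendsto hl hr (by
      filter_upwards [Ioo_mem_nhdsLT hsτ] with t ht
      exact hyQ s t hs ht.1 ht.2)
    simpa using hle
  refine (isHolderOn_iff_dist_le h0).2 ⟨Q, hQ, fun s hs t ht hst => ?_⟩
  have hts : 0 ≤ t - s := by linarith
  rw [dist_comm, dist_eq_norm]
  rcases lt_or_ge s τ with hsτ | hsτ
  · rcases lt_or_ge t τ with htτ | htτ
    · rcases hst.eq_or_lt with rfl | hst
      · simpa using mul_nonneg hQ (Real.rpow_nonneg hts γ)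
      · exact hyQ s t hs.1 hst htτ
    · rw [hy.eq_zero t ⟨htτ, ht.2⟩, zero_sub, norm_neg]
      have hτs : 0 ≤ τ - s := by linarith
      refine (hτ s hs.1 hsτ).trans ?_
      gcongr
  · rw [hy.eq_zero s ⟨hsτ, hs.2⟩, hy.eq_zero t ⟨hsτ.trans hst, ht.2⟩]
    simpa using mul_nonneg hQ (Real.rpow_nonneg hts γ)
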